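/- Graphs are finite, simple and undirected. A $t$-track layout of a graph $G$ is a partition of $V(G)$ into $t$ (possibly empty) independent sets $V_1,\dots,V_t$, called tracks, together with a total order $<_i$ of each $V_i$, such that there is no X-crossing, that is, there are no two edges $uv$ and $xy$ with $u,x\in V_i$, $v,y\in V_j$, $i\ne j$, $u<_i x$ and $y<_j v$. For cliques $C_1, C_2$ of $G$ write $C_1\prec C_2$ if $u\le_i w$ for every $1\le i\le t$ and all $u\in V_i\cap C_1$, $w\in V_i\cap C_2$. A set $S$ of maximal cliques of $G$ is nicely ordered if its members can be enumerated as $C_1,\dots,C_{|S|}$ (each once) such that $C_i\prec C_j$ for all $1\le i<j\le |S|$. The layout is $c$-clique-colorable if the set of all maximal cliques of $G$ (maximal under inclusion) can be partitioned into $c$ (possibly empty) nicely ordered subsets. A graph is outerplanar if it can be drawn without crossings in a closed disk of the plane with all its vertices on the boundary circle, the edges being simple arcs in the disk. **Lemma.** (a) Every path has a $1$-clique-colorable $2$-track layout. (b) Every tree has a $2$-clique-colorable $3$-track layout. (c) Every outerplanar graph has a $2$-clique-colorable $5$-track layout. -/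

import Mathlib

/-- `G` is a path: it is isomorphic to the path on the vertices `0, 1, …, n - 1`. -/
def SimpleGraph.IsPathGraph {V : Type*} (G : SimpleGraph V) : Prop :=
  ∃ n : ℕ, Nonempty (G ≃g SimpleGraph.pathGraph n)

/-- A crossing-free drawing of `G` in the closed unit disk of the plane with all vertices on the
boundary circle: vertices are distinct points of the circle, and an edge `uv` is a simple arc in
the disk from `u` to `v` which passes through no other vertex and meets the arc of any other edge
only in a common endvertex of the two edges. -/
structure OuterplanarDrawing {V : Type*} (G : SimpleGraph V) where
  /-- the position of a vertex -/
  pt : V → ℂ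
  /-- the arc that represents an edge (the values at non-edges are irrelevant) -/
  arc : Sym2 V → Set ℂ
  pt_injective : Function.Injective pt
  pt_mem_circle : ∀ v, pt v ∈ Metric.sphere (0 : ℂ) 1
  arc_simple : ∀ u v, G.Adj u v →
    ∃ γ : Path (pt u) (pt v), Function.Injective γ ∧ Set.range γ = arc s(u, v)
  arc_subset_disk : ∀ e ∈ G.edgeSet, arc e ⊆ Metric.closedBall (0 : ℂ) 1
  mem_of_pt_mem_arc : ∀ e ∈ G.edgeSet, ∀ w, pt w ∈ arc e → w ∈ e
  arc_inter_arc : ∀ e ∈ G.edgeSet, ∀ f ∈ G.edgeSet, e ≠ f →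
    arc e ∩ arc f ⊆ pt '' {w | w ∈ e ∧ w ∈ f}

/-- `G` is outerplanar: it has a crossing-free drawing with all vertices on the boundary of the
outer region, which is taken to be the outside of a disk. -/
def SimpleGraph.IsOuterplanar {V : Type*} (G : SimpleGraph V) : Prop :=
  Nonempty (OuterplanarDrawing G)

/-- A `t`-track layout of `G`. Tracks may be empty. The relation `lt` is only meaningful (and only
used) between vertices of the same track. -/
structure TrackLayout {V : Type*} (G : SimpleGraph V) (t : ℕ) where
  /-- the track of a vertex -/
  track : V → Fin t
  /-- the order of the vertices within each track -/
  lt : V → V → Prop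
  lt_total_order : ∀ i, IsStrictTotalOrder {v : V // track v = i} (fun u v => lt u v)
  /-- every track is an independent set -/
  track_ne : ∀ u v, G.Adj u v → track u ≠ track v
  /-- there are no X-crossings -/
  no_crossing : ∀ u v x y, G.Adj u v → G.Adj x y → track u = track x → track v = track y →
    lt u x → ¬ lt y v

namespace TrackLayout

variable {V : Type*} {G : SimpleGraph V} {t : ℕ}

/-- `C₁` precedes `C₂`: on every track, each vertex of `C₁` is at most each vertex of `C₂`. -/
def Precedes (L : TrackLayout G t) (C₁ C₂ : Set V) : Prop :=
  ∀ u ∈ C₁, ∀ w ∈ C₂, L.track u = L.track w → u = w ∨ L.lt u w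

/-- `S` is nicely ordered: its members can be listed without repetition as `C₁, …, C_m` such that
`C_i` precedes `C_j` whenever `i < j`. -/
def NicelyOrdered (L : TrackLayout G t) (S : Set (Set V)) : Prop :=
  ∃ l : List (Set V), l.Nodup ∧ (∀ C, C ∈ l ↔ C ∈ S) ∧ l.Pairwise L.Precedes

/-- `S` can be partitioned into `c` (possibly empty) nicely ordered subsets. -/
def CliquesColorable (L : TrackLayout G t) (c : ℕ) (S : Set (Set V)) : Prop :=
  ∃ color : Set V → Fin c, ∀ i, L.NicelyOrdered {C | C ∈ S ∧ color C = i}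

/-- The layout is `c`-clique-colorable: the set of all inclusion-maximal cliques of `G` can be
partitioned into `c` nicely ordered subsets. -/
def IsCliqueColorable (L : TrackLayout G t) (c : ℕ) : Prop :=
  L.CliquesColorable c {C : Set V | Maximal G.IsClique C}

end TrackLayout

/-! All three layouts come from levels such that an edge joins different levels at distance at most
s. Reading levels modulo 2s+1 and ordering each track by level first creates no new X-crossing
(`TrackLayout.ofLevels`). Paths need only parity.

In a tree the levels are distances from a root, each ordered consistently with the parents. An edge
whose upper end has depth d gets color d mod 2: edges of one color either have the same d or lie on
disjoint pairs of levels.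

For an outerplanar graph, a winding argument turns the drawing into a numbering without alternating
edges. The polygon is then triangulated recursively, each new apex being placed so that its triangle
occupies three consecutive levels m, m+1, m+2 and everything under an edge lies above one of its
ends. Thus nested edges never join the same two levels, and X-crossings disappear. Every clique lies
in a triangle, colored by the parity of ⌊m/2⌋: triangles of one color either occupy disjoint ranges
of levels or share ⌊m/2⌋ = k, hence the levels 2k+1 and 2k+2, which determine their order up to
ties. -/

/-! ### From plane drawings to non-alternating numberings -/

theorem Complex.re_lt_one_of_norm_le_one {z : ℂ} (hz : ‖z‖ ≤ 1) (hz1 : z ≠ 1) : z.re < 1 := by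
  refine lt_of_le_of_ne ((Complex.re_le_norm z).trans hz) fun h => hz1 ?_
  have h2 : z.re * z.re + z.im * z.im ≤ 1 := by
    rw [← Complex.normSq_apply, Complex.normSq_eq_norm_sq]
    nlinarith [norm_nonneg z]
  have h3 : z.im = 0 := by
    rw [h] at h2
    nlinarith [mul_self_nonneg z.im]
  exact Complex.ext h h3

theorem Complex.one_sub_div_mem_slitPlane {z w : ℂ} (hw : ‖w‖ = 1) (hz : ‖z‖ ≤ 1) (h : z ≠ w) :
    1 - z / w ∈ Complex.slitPlane := by
  have hw0 : w ≠ 0 := by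
    rintro rfl
    simp at hw
  refine Or.inl ?_
  have := Complex.re_lt_one_of_norm_le_one (z := z / w) (by simpa [hw] using hz)
    (fun h1 => h ((div_eq_one_iff_eq hw0).1 h1))
  simpa using this

theorem Complex.arg_one_sub_exp {θ : ℝ} (h0 : 0 < θ) (h1 : θ < 2 * Real.pi) :
    Complex.arg (1 - Complex.exp (θ * Complex.I)) = (θ - Real.pi) / 2 := by
  have hs : 0 < 2 * Real.sin (θ / 2) := by
    have := Real.sin_pos_of_pos_of_lt_pi (x := θ / 2) (by linarith) (by linarith)
    linarith
  have key : 1 - Complex.exp (θ * Complex.I) = ((2 * Real.sin (θ / 2) : ℝ) : ℂ) *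
      (Complex.cos (((θ - Real.pi) / 2 : ℝ)) + Complex.sin (((θ - Real.pi) / 2 : ℝ)) *
        Complex.I) := by
    have e1 : (θ - Real.pi) / 2 = θ / 2 - Real.pi / 2 := by ring
    rw [e1, ← Complex.ofReal_cos, ← Complex.ofReal_sin, Real.cos_sub_pi_div_two,
      Real.sin_sub_pi_div_two, Complex.exp_mul_I, ← Complex.ofReal_cos, ← Complex.ofReal_sin]
    have e2 : θ = 2 * (θ / 2) := by ring
    have hc : Real.cos θ = 1 - 2 * Real.sin (θ / 2) ^ 2 := by
      conv_lhs => rw [e2, Real.cos_two_mul, Real.cos_sq']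
      ring
    have hsn : Real.sin θ = 2 * Real.sin (θ / 2) * Real.cos (θ / 2) := by
      conv_lhs => rw [e2, Real.sin_two_mul]
    rw [hc, hsn]
    generalize Real.sin (θ / 2) = x
    generalize Real.cos (θ / 2) = y
    push_cast
    ring
  rw [key, Complex.arg_mul_cos_add_sin_mul_I hs]
  constructor <;> linarith

theorem Complex.eq_exp_arg_of_norm_eq_one {z : ℂ} (hz : ‖z‖ = 1) :
    z = Complex.exp (z.arg * Complex.I) := by
  conv_lhs => rw [← Complex.norm_mul_exp_arg_mul_I z, hz]
  simp

theorem Complex.arg_one_sub_div {x y : ℂ} (hx : ‖x‖ = 1) (hy : ‖y‖ = 1) (h : y.arg < x.arg) :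
    Complex.arg (1 - x / y) = (x.arg - y.arg - Real.pi) / 2 := by
  have e : x / y = Complex.exp ((x.arg - y.arg : ℝ) * Complex.I) := by
    conv_lhs => rw [Complex.eq_exp_arg_of_norm_eq_one hx, Complex.eq_exp_arg_of_norm_eq_one hy]
    rw [← Complex.exp_sub]
    push_cast
    ring_nf
  rw [e, Complex.arg_one_sub_exp (by linarith)]
  linarith [Complex.arg_le_pi x, Complex.neg_pi_lt_arg y]

theorem Complex.arg_one_sub_div' {x y : ℂ} (hx : ‖x‖ = 1) (hy : ‖y‖ = 1) (h : y.arg < x.arg) :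
    Complex.arg (1 - y / x) = (y.arg - x.arg + Real.pi) / 2 := by
  have e : y / x = Complex.exp ((y.arg - x.arg + 2 * Real.pi : ℝ) * Complex.I) := by
    conv_lhs => rw [Complex.eq_exp_arg_of_norm_eq_one hx, Complex.eq_exp_arg_of_norm_eq_one hy]
    rw [← Complex.exp_sub]
    push_cast
    rw [add_mul, Complex.exp_add, Complex.exp_two_pi_mul_I, mul_one]
    ring_nf
  rw [e, Complex.arg_one_sub_exp]
  · ring
  · linarith [Complex.arg_le_pi x, Complex.neg_pi_lt_arg y]
  · linarith

/-- If `exp ∘ g`, divided by `k`, avoids the negative real axis, then the variation of the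
imaginary part of `g` is that of the principal argument. -/
theorem Complex.im_sub_im_eq_arg_sub_arg {g : ℝ → ℂ} (hg : Continuous g) {h : ℝ → ℂ}
    (hh : Continuous h) {k : ℂ} (hk : k ≠ 0) (hs : ∀ t, h t ∈ Complex.slitPlane)
    (e : ∀ t, Complex.exp (g t) = k * h t) :
    (g 1).im - (g 0).im = (h 1).arg - (h 0).arg := by
  -- This is a lift of the constant `k` through the covering `exp`, so it is constant.
  let E : C(ℝ, ℂ) := ⟨fun t => g t - Complex.log (h t), hg.sub (hh.clog hs)⟩
  have hE : ∀ t, Complex.exp (E t) = k := fun t => by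
    have h0 : h t ≠ 0 := Complex.slitPlane_ne_zero (hs t)
    change Complex.exp (g t - Complex.log (h t)) = k
    rw [Complex.exp_sub, e, Complex.exp_log h0, mul_div_cancel_right₀ _ h0]
  obtain ⟨F, -, hF⟩ := Complex.isCoveringMapOn_exp.existsUnique_continuousMap_lifts
    (ContinuousMap.const ℝ k) (a₀ := (0 : ℝ)) (e₀ := E 0) (hE 0) (fun _ => hk)
  have h1 : E = F := hF E ⟨rfl, funext hE⟩
  have h2 : ContinuousMap.const ℝ (E 0) = F := hF _ ⟨rfl, funext fun _ => hE 0⟩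
  have h3 : E 1 = E 0 := by
    conv_lhs => rw [h1, ← h2]
    rfl
  have h4 := congrArg Complex.im h3
  simp only [E, ContinuousMap.coe_mk, Complex.sub_im, Complex.log_im] at h4
  linarith

/-- Two paths in the closed unit disk whose ends alternate on the unit circle intersect. -/
theorem Path.exists_eq_of_alternating {a b c d : ℂ} (ha : ‖a‖ = 1) (hb : ‖b‖ = 1) (hc : ‖c‖ = 1)
    (hd : ‖d‖ = 1) (hac : a.arg < c.arg) (hcb : c.arg < b.arg) (hbd : b.arg < d.arg)
    (γ : Path a b) (δ : Path c d) (hγ : ∀ t, ‖γ t‖ ≤ 1) (hδ : ∀ t, ‖δ t‖ ≤ 1) :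
    ∃ s t, γ s = δ t := by
  by_contra! hne
  have hγ' : ∀ t, ‖γ.extend t‖ ≤ 1 := fun t => hγ _
  have hδ' : ∀ t, ‖δ.extend t‖ ≤ 1 := fun t => hδ _
  have hne' : ∀ s t, γ.extend s ≠ δ.extend t := fun s t => hne _ _
  have nz : ∀ {z : ℂ}, ‖z‖ = 1 → z ≠ 0 := fun h h0 => by simp [h0] at h
  have huniv : IsSimplyConnected (Set.univ : Set (ℝ × ℝ)) := by
    have := convex_univ (𝕜 := ℝ) (E := ℝ × ℝ) |>.contractibleSpace Set.univ_nonempty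
    exact SimplyConnectedSpace.ofContractible (Set.univ : Set (ℝ × ℝ))
  -- If the paths are disjoint, γ(s) − δ(t) never vanishes and has a continuous logarithm on the
  -- plane. Its variation along each side of the unit square is explicit, because there one of the
  -- two points stays fixed on the circle.
  obtain ⟨G, hG, hGe⟩ := Complex.exists_continuousOn_eqOn_exp_comp (X := ℝ × ℝ) (U := Set.univ)
    huniv isOpen_univ
    (g := fun p => γ.extend p.1 - δ.extend p.2) (by fun_prop)
    (by rintro ⟨p, -, hp⟩; exact hne' _ _ (sub_eq_zero.1 hp))
  rw [continuousOn_univ] at hG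
  have hGe' : ∀ s t, Complex.exp (G (s, t)) = γ.extend s - δ.extend t :=
    fun s t => hGe (Set.mem_univ (s, t))
  have row : ∀ t, ‖δ.extend t‖ = 1 → (G (1, t)).im - (G (0, t)).im =
      (1 - b / δ.extend t).arg - (1 - a / δ.extend t).arg := fun t ht => by
    have := Complex.im_sub_im_eq_arg_sub_arg (g := fun s => G (s, t)) (by fun_prop)
      (h := fun s => 1 - γ.extend s / δ.extend t) (by fun_prop) (neg_ne_zero.2 (nz ht))
      (fun s => Complex.one_sub_div_mem_slitPlane ht (hγ' s) (hne' s t))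
      (fun s => by rw [hGe']; field_simp [nz ht]; ring)
    simpa using this
  have col : ∀ s, ‖γ.extend s‖ = 1 → (G (s, 1)).im - (G (s, 0)).im =
      (1 - d / γ.extend s).arg - (1 - c / γ.extend s).arg := fun s hs => by
    have := Complex.im_sub_im_eq_arg_sub_arg (g := fun t => G (s, t)) (by fun_prop)
      (h := fun t => 1 - δ.extend t / γ.extend s) (by fun_prop) (nz hs)
      (fun t => Complex.one_sub_div_mem_slitPlane hs (hδ' t) (hne' s t).symm)
      (fun t => by rw [hGe']; field_simp [nz hs])
    simpa using this
  have r0 := row 0 (by simpa using hc)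
  have r1 := row 1 (by simpa using hd)
  have c0 := col 0 (by simpa using ha)
  have c1 := col 1 (by simpa using hb)
  simp only [Path.extend_zero, Path.extend_one] at r0 r1 c0 c1
  rw [Complex.arg_one_sub_div hb hc hcb, Complex.arg_one_sub_div' hc ha hac] at r0
  rw [Complex.arg_one_sub_div' hd hb hbd,
    Complex.arg_one_sub_div' hd ha (hac.trans (hcb.trans hbd))] at r1
  rw [Complex.arg_one_sub_div hd ha (hac.trans (hcb.trans hbd)),
    Complex.arg_one_sub_div hc ha hac] at c0
  rw [Complex.arg_one_sub_div hd hb hbd, Complex.arg_one_sub_div' hb hc hcb] at c1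
  -- The two ways around the square from (0, 0) to (1, 1) give variations that differ by 2π.
  linarith [Real.pi_pos]

theorem OuterplanarDrawing.not_alternating {V : Type*} {G : SimpleGraph V}
    (D : OuterplanarDrawing G) {a b c d : V} (hab : G.Adj a b) (hcd : G.Adj c d)
    (hac : (D.pt a).arg < (D.pt c).arg) (hcb : (D.pt c).arg < (D.pt b).arg)
    (hbd : (D.pt b).arg < (D.pt d).arg) : False := by
  obtain ⟨γ, -, hγ⟩ := D.arc_simple a b hab
  obtain ⟨δ, -, hδ⟩ := D.arc_simple c d hcd
  have hn : ∀ v, ‖D.pt v‖ = 1 := fun v => by simpa using D.pt_mem_circle v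
  have hγ1 : ∀ t, γ t ∈ D.arc s(a, b) := fun t => hγ ▸ Set.mem_range_self t
  have hδ1 : ∀ t, δ t ∈ D.arc s(c, d) := fun t => hδ ▸ Set.mem_range_self t
  obtain ⟨s, t, hst⟩ := Path.exists_eq_of_alternating (hn a) (hn b) (hn c) (hn d) hac hcb hbd γ δ
    (fun t => by simpa using D.arc_subset_disk s(a, b) hab (hγ1 t))
    (fun t => by simpa using D.arc_subset_disk s(c, d) hcd (hδ1 t))
  have ne : ∀ {v w : V}, (D.pt v).arg < (D.pt w).arg → v ≠ w := by
    rintro v _ h rfl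
    exact lt_irrefl _ h
  have h1 := ne hac
  have h2 := ne hcb
  have h3 := ne hbd
  have h4 := ne (hac.trans (hcb.trans hbd))
  obtain ⟨w, ⟨hw1, hw2⟩, -⟩ := D.arc_inter_arc s(a, b) hab s(c, d) hcd
    (by
      intro h
      have : a ∈ s(c, d) := h ▸ Sym2.mem_mk_left a b
      rw [Sym2.mem_iff] at this
      tauto) ⟨hγ1 s, hst ▸ hδ1 t⟩
  rw [Sym2.mem_iff] at hw1 hw2
  rcases hw1 with rfl | rfl <;> rcases hw2 with h | h <;> simp_all

/-- The vertices of an outerplanar graph can be numbered such that no two edges alternate. -/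
theorem SimpleGraph.IsOuterplanar.exists_numbering {V : Type*} [Finite V] {G : SimpleGraph V}
    (hG : G.IsOuterplanar) : ∃ pos : V → ℕ, Function.Injective pos ∧
      ∀ a b c d, G.Adj a b → G.Adj c d → pos a < pos c → pos c < pos b → pos b < pos d → False := by
  obtain ⟨D⟩ := hG
  let θ : V → ℝ := fun v => (D.pt v).arg
  have hθ : Function.Injective θ := fun v w h => D.pt_injective (Complex.ext_norm_arg
    (by rw [mem_sphere_zero_iff_norm.1 (D.pt_mem_circle v),
      mem_sphere_zero_iff_norm.1 (D.pt_mem_circle w)]) h)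
  have hmono : ∀ {v w}, θ v ≤ θ w → {u | θ u < θ v}.ncard ≤ {u | θ u < θ w}.ncard :=
    fun h => Set.ncard_le_ncard (fun u hu => lt_of_lt_of_le hu h) (Set.toFinite _)
  have hlt : ∀ {v w}, {u | θ u < θ v}.ncard < {u | θ u < θ w}.ncard → θ v < θ w :=
    fun h => lt_of_not_ge fun h' => (hmono h').not_gt h
  have hstrict : ∀ {v w}, θ v < θ w → {u | θ u < θ v}.ncard < {u | θ u < θ w}.ncard :=
    fun {v w} h => Set.ncard_lt_ncard
      ⟨fun u hu => lt_trans hu h, fun h' => lt_irrefl _ (show θ v < θ v from h' (show v ∈ {u | θ u < θ w} from h))⟩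
      (Set.toFinite _)
  -- Each vertex is numbered by its rank in the order of arguments.
  refine ⟨fun v => {u | θ u < θ v}.ncard, fun v w h => hθ ?_, ?_⟩
  · rcases lt_trichotomy (θ v) (θ w) with h' | h' | h'
    · exact absurd h (hstrict h').ne
    · exact h'
    · exact absurd h (hstrict h').ne'
  · intro a b c d hab hcd h1 h2 h3
    exact D.not_alternating hab hcd (hlt h1) (hlt h2) (hlt h3)

/-! ### Leveled triangulations of a polygon -/

/-- An outerplanar triangulation `H` (edges listed with the smaller end first) of the polygon on
the numbers `a, …, b` which contains the edges of `E`, with levels such that the ends of an edge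
are at distance one or two and the numbers below an edge have a larger level than one of its
ends. -/
structure IsLeveledTriangulation (E : ℕ → ℕ → Prop) (ℓ : ℕ → ℕ) (H : ℕ → ℕ → Prop) (a b : ℕ) :
    Prop where
  base : H a b
  mem : ∀ x y, H x y → a ≤ x ∧ x < y ∧ y ≤ b
  span : ∀ x y, H x y → ℓ x ≠ ℓ y ∧ ℓ x ≤ ℓ y + 2 ∧ ℓ y ≤ ℓ x + 2
  inside : ∀ x y z, H x y → x < z → z < y → ℓ x < ℓ z ∨ ℓ y < ℓ z
  not_alternating : ∀ x y x' y', H x y → H x' y' → x < x' → x' < y → y < y' → False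
  cover : ∀ x y, E x y → a ≤ x → x < y → y ≤ b → H x y
  clique : ∀ S : Set ℕ, S ⊆ Set.Icc a b → S.Pairwise E →
    b = a + 1 ∧ S ⊆ {a, b} ∨ ∃ x y z, H x y ∧ H y z ∧ H x z ∧ S ⊆ {x, y, z}

/-- The two triangulations meet only at the apex `c`, and the triangle `a, c, b` closes them up. By
`hsep`, a clique with members on both sides of `c` lies in that triangle. -/
theorem IsLeveledTriangulation.glue {E ℓ₁ H₁ ℓ₂ H₂} {a b c : ℕ}
    (h₁ : IsLeveledTriangulation E ℓ₁ H₁ a c) (h₂ : IsLeveledTriangulation E ℓ₂ H₂ c b)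
    (hc : ℓ₁ c = ℓ₂ c) (hac : a < c) (hcb : c < b)
    (hsep : ∀ x y, E x y → a ≤ x → x < c → c < y → y ≤ b → x = a ∧ y = b)
    (hspan : ℓ₁ a ≠ ℓ₂ b ∧ ℓ₁ a ≤ ℓ₂ b + 2 ∧ ℓ₂ b ≤ ℓ₁ a + 2)
    (hin : ℓ₁ a < ℓ₁ c ∨ ℓ₂ b < ℓ₁ c) :
    IsLeveledTriangulation E (fun z => if z ≤ c then ℓ₁ z else ℓ₂ z)
      (fun x y => x = a ∧ y = b ∨ H₁ x y ∨ H₂ x y) a b := by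
  have m₁ := h₁.mem
  have m₂ := h₂.mem
  have e₂ : ∀ z, c ≤ z → (if z ≤ c then ℓ₁ z else ℓ₂ z) = ℓ₂ z := fun z hz => by
    split_ifs with h
    · rw [le_antisymm h hz, hc]
    · rfl
  have e₁ : ∀ z, z ≤ c → (if z ≤ c then ℓ₁ z else ℓ₂ z) = ℓ₁ z := fun z hz => if_pos hz
  refine ⟨Or.inl ⟨rfl, rfl⟩, ?_, ?_, ?_, ?_, ?_, ?_⟩
  · rintro x y (⟨rfl, rfl⟩ | h | h)
    · omega
    · have := m₁ _ _ h
      omega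
    · have := m₂ _ _ h
      omega
  · rintro x y (⟨rfl, rfl⟩ | h | h)
    · rw [e₁ x hac.le, e₂ y hcb.le]
      exact hspan
    · obtain ⟨_, _, _⟩ := m₁ _ _ h
      rw [e₁ x (by omega), e₁ y (by omega)]
      exact h₁.span _ _ h
    · obtain ⟨_, _, _⟩ := m₂ _ _ h
      rw [e₂ x (by omega), e₂ y (by omega)]
      exact h₂.span _ _ h
  · rintro x y z (⟨rfl, rfl⟩ | h | h) hxz hzy
    · simp only [e₁ x hac.le, e₂ y hcb.le]
      rcases lt_trichotomy z c with hz | rfl | hz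
      · have := h₁.inside _ _ z h₁.base hxz hz
        rw [e₁ z hz.le]
        omega
      · rw [e₁ z le_rfl]
        exact hin
      · have := h₂.inside _ _ z h₂.base hz hzy
        rw [e₂ z hz.le]
        omega
    · obtain ⟨_, _, _⟩ := m₁ _ _ h
      simp only [e₁ x (by omega), e₁ y (by omega), e₁ z (by omega)]
      exact h₁.inside _ _ _ h hxz hzy
    · obtain ⟨_, _, _⟩ := m₂ _ _ h
      simp only [e₂ x (by omega), e₂ y (by omega), e₂ z (by omega)]
      exact h₂.inside _ _ _ h hxz hzy
  · rintro x y x' y' (⟨rfl, rfl⟩ | h | h) (⟨rfl, rfl⟩ | h' | h') l1 l2 l3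
    · omega
    · have := m₁ _ _ h'
      omega
    · have := m₂ _ _ h'
      omega
    · have := m₁ _ _ h
      omega
    · exact h₁.not_alternating _ _ _ _ h h' l1 l2 l3
    · have := m₁ _ _ h
      have := m₂ _ _ h'
      omega
    · have := m₂ _ _ h
      omega
    · have := m₂ _ _ h
      have := m₁ _ _ h'
      omega
    · exact h₂.not_alternating _ _ _ _ h h' l1 l2 l3
  · intro x y h hax hxy hyb
    rcases le_or_gt y c with hy | hy
    · exact Or.inr (Or.inl (h₁.cover _ _ h hax hxy hy))
    · rcases le_or_gt c x with hx | hx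
      · exact Or.inr (Or.inr (h₂.cover _ _ h hx hxy hyb))
      · exact Or.inl (hsep x y h hax hx hy hyb)
  · intro S hS hSE
    right
    by_cases hl : S ⊆ Set.Icc a c
    · rcases h₁.clique S hl hSE with ⟨-, h⟩ | ⟨x, y, z, hxy, hyz, hxz, h⟩
      · exact ⟨a, c, b, Or.inr (Or.inl h₁.base), Or.inr (Or.inr h₂.base), Or.inl ⟨rfl, rfl⟩,
          h.trans (by grind)⟩
      · exact ⟨x, y, z, Or.inr (Or.inl hxy), Or.inr (Or.inl hyz), Or.inr (Or.inl hxz), h⟩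
    by_cases hr : S ⊆ Set.Icc c b
    · rcases h₂.clique S hr hSE with ⟨-, h⟩ | ⟨x, y, z, hxy, hyz, hxz, h⟩
      · exact ⟨a, c, b, Or.inr (Or.inl h₁.base), Or.inr (Or.inr h₂.base), Or.inl ⟨rfl, rfl⟩,
          h.trans (by grind)⟩
      · exact ⟨x, y, z, Or.inr (Or.inr hxy), Or.inr (Or.inr hyz), Or.inr (Or.inr hxz), h⟩
    refine ⟨a, c, b, Or.inr (Or.inl h₁.base), Or.inr (Or.inr h₂.base), Or.inl ⟨rfl, rfl⟩, ?_⟩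
    obtain ⟨y, hyS, hy⟩ := Set.not_subset.1 hl
    obtain ⟨x, hxS, hx⟩ := Set.not_subset.1 hr
    have key : ∀ x ∈ S, ∀ y ∈ S, x < c → c < y → x = a ∧ y = b := fun x hx y hy hxc hcy =>
      hsep x y (hSE hx hy (by omega)) (hS hx).1 hxc hcy (hS hy).2
    have hx' : x < c := by
      have := hS hxS
      simp only [Set.mem_Icc] at this hx
      omega
    have hy' : c < y := by
      have := hS hyS
      simp only [Set.mem_Icc] at this hy
      omega
    intro z hz
    rcases lt_trichotomy z c with h | h | h
    · exact Or.inl (key z hz y hyS h hy').1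
    · exact Or.inr (Or.inl h)
    · exact Or.inr (Or.inr (key x hxS z hz hx' h).2)

/-- The farthest neighbor of `a` before `b` works, since an edge over it would alternate with its
edge to `a`. Without such a neighbor, `a + 1` works. -/
theorem exists_apex {E : ℕ → ℕ → Prop}
    (hE : ∀ a b c d, E a b → E c d → a < c → c < b → b < d → False) {a b : ℕ} (hab : a + 1 < b) :
    ∃ c, a < c ∧ c < b ∧
      ∀ x y, E x y → a ≤ x → x < c → c < y → y ≤ b → x = a ∧ y = b := by
  classical
  by_cases h : ∃ c, a < c ∧ c < b ∧ E a c
  · obtain ⟨c₀, h₀⟩ := h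
    obtain ⟨c, ⟨hac, hcb, hc⟩, hmax⟩ : ∃ c, (a < c ∧ c < b ∧ E a c) ∧
        ∀ d, a < d → d < b → E a d → d ≤ c :=
      ⟨_, Nat.findGreatest_spec (P := fun c => a < c ∧ c < b ∧ E a c) h₀.2.1.le h₀,
        fun d h1 h2 h3 => Nat.le_findGreatest h2.le ⟨h1, h2, h3⟩⟩
    refine ⟨c, hac, hcb, fun x y hxy hax hxc hcy hyb => ?_⟩
    rcases hax.eq_or_lt with rfl | hax
    · refine ⟨rfl, hyb.antisymm (le_of_not_gt fun h => ?_)⟩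
      have := hmax y (by omega) h hxy
      omega
    · exact (hE a c x y hc hxy hax hxc hcy).elim
  · refine ⟨a + 1, by omega, hab, fun x y hxy hax hxc hcy hyb => ?_⟩
    obtain rfl : x = a := by omega
    refine ⟨rfl, hyb.antisymm (le_of_not_gt fun h' => h ⟨y, by omega, h', hxy⟩)⟩

theorem exists_isLeveledTriangulation {E : ℕ → ℕ → Prop}
    (hE : ∀ a b c d, E a b → E c d → a < c → c < b → b < d → False) (n : ℕ) :
    ∀ a b la lb : ℕ, b ≤ a + n → a < b → la ≠ lb → la ≤ lb + 2 → lb ≤ la + 2 →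
      ∃ ℓ H, IsLeveledTriangulation E ℓ H a b ∧ ℓ a = la ∧ ℓ b = lb := by
  induction n with
  | zero =>
    intro a b la lb h1 h2
    omega
  | succ n ih =>
    intro a b la lb hn hab hne h1 h2
    rcases eq_or_ne b (a + 1) with rfl | hb
    · refine ⟨fun z => if z = a then la else lb, fun x y => x = a ∧ y = a + 1,
        ⟨⟨rfl, rfl⟩, ?_, ?_, ?_, ?_, ?_, ?_⟩, by simp, by simp⟩
      · rintro x y ⟨rfl, rfl⟩
        omega
      · rintro x y ⟨rfl, rfl⟩
        simp [hne, h1, h2]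
      · rintro x y z ⟨rfl, rfl⟩
        omega
      · rintro x y x' y' ⟨rfl, rfl⟩ ⟨rfl, rfl⟩
        omega
      · intro x y
        omega
      · intro S hS _
        refine Or.inl ⟨rfl, fun x hx => ?_⟩
        have := hS hx
        simp only [Set.mem_Icc, Set.mem_insert_iff, Set.mem_singleton_iff] at this ⊢
        omega
    · obtain ⟨c, hac, hcb, hsep⟩ := exists_apex hE (a := a) (b := b) (by omega)
      -- If the base levels differ by one, the apex goes just above both; if by two, between them.
      -- Either way the triangle occupies three consecutive levels and the apex is above an end of
      -- the base.
      obtain ⟨lc, g1, g2, g3, g4, g5, g6, g7⟩ : ∃ lc : ℕ, la ≠ lc ∧ la ≤ lc + 2 ∧ lc ≤ la + 2 ∧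
          lc ≠ lb ∧ lc ≤ lb + 2 ∧ lb ≤ lc + 2 ∧ (la < lc ∨ lb < lc) := by
        by_cases h : la = lb + 1 ∨ lb = la + 1
        · exact ⟨max la lb + 1, by omega⟩
        · exact ⟨min la lb + 1, by omega⟩
      obtain ⟨ℓ₁, H₁, t₁, e1, e2⟩ := ih a c la lc (by omega) hac g1 g2 g3
      obtain ⟨ℓ₂, H₂, t₂, e3, e4⟩ := ih c b lc lb (by omega) hcb g4 g5 g6
      exact ⟨_, _, t₁.glue t₂ (by omega) hac hcb hsep (by omega) (by omega),
        by simp [hac.le, e1], by simp [hcb, e4]⟩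

/-- In the numbering, an X-crossing would be a nested or an alternating pair of edges. Both ends of
a strictly nested edge lie above the lower end of the outer one, so the two edges cannot join the
same levels. -/
theorem IsLeveledTriangulation.not_cross {E ℓ H} {a b : ℕ} (h : IsLeveledTriangulation E ℓ H a b)
    {u v x y : ℕ} (huv : H u v ∨ H v u) (hxy : H x y ∨ H y x) (hux : ℓ u = ℓ x)
    (hvy : ℓ v = ℓ y) (hlt : u < x) : ¬ y < v := by
  intro hyv
  have nest : ∀ p q r s, H p q → H r s → p < r → s < q → ℓ p = ℓ r ∧ ℓ q = ℓ s ∨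
      ℓ p = ℓ s ∧ ℓ q = ℓ r → False := by
    intro p q r s h1 h2 h3 h4 h5
    have := h.mem _ _ h2
    have := h.inside p q r h1 h3 (by omega)
    have := h.inside p q s h1 (by omega) h4
    omega
  rcases huv with huv | huv <;> rcases hxy with hxy | hxy
  · exact nest _ _ _ _ huv hxy hlt hyv (by omega)
  · have a1 := h.span _ _ huv
    have a2 := h.mem _ _ huv
    have a3 := h.mem _ _ hxy
    rcases lt_trichotomy u y with h1 | rfl | h1
    · rcases lt_trichotomy x v with h2 | rfl | h2
      · exact nest _ _ _ _ huv hxy h1 h2 (by omega)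
      · omega
      · exact h.not_alternating _ _ _ _ huv hxy h1 hyv h2
    · omega
    · rcases lt_trichotomy x v with h2 | rfl | h2
      · exact h.not_alternating _ _ _ _ hxy huv h1 hlt h2
      · omega
      · exact nest _ _ _ _ hxy huv h1 h2 (by omega)
  · have a2 := h.mem _ _ huv
    have a3 := h.mem _ _ hxy
    omega
  · exact nest _ _ _ _ hxy huv hyv hlt (by omega)

/-! ### Ranked cliques and wrapped levels -/

namespace TrackLayout

variable {V : Type*} {G : SimpleGraph V}

/-- A layout is `c`-clique-colorable if the cliques can be colored and ranked such that of any two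
cliques of the same color the one of smaller rank precedes the other. -/
theorem isCliqueColorable_of_rank [Finite V] {t c : ℕ} (L : TrackLayout G t) {α : Type*}
    [LinearOrder α] (color : Set V → Fin c) (rank : Set V → α)
    (h : ∀ C D, G.IsClique C → G.IsClique D → color C = color D → rank C ≤ rank D →
      L.Precedes C D) : L.IsCliqueColorable c := by
  classical
  refine ⟨color, fun i => ?_⟩
  let r : Set V → Set V → Prop := fun C D => rank C ≤ rank D
  have : Std.Total r := ⟨fun C D => le_total (rank C) (rank D)⟩
  have : IsTrans (Set V) r := ⟨fun _ _ _ => le_trans⟩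
  have hfin := Set.toFinite {C | C ∈ {C : Set V | Maximal G.IsClique C} ∧ color C = i}
  have hmem : ∀ C, C ∈ hfin.toFinset.toList.insertionSort r ↔
      C ∈ {C | C ∈ {C : Set V | Maximal G.IsClique C} ∧ color C = i} := fun C => by
    rw [List.mem_insertionSort, Finset.mem_toList, Set.Finite.mem_toFinset]
  refine ⟨hfin.toFinset.toList.insertionSort r, ?_, hmem, ?_⟩
  · exact (List.perm_insertionSort r _).nodup_iff.2 (Finset.nodup_toList _)
  · refine (List.pairwise_insertionSort r _).imp_of_mem fun {C D} hC hD hr => ?_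
    obtain ⟨hC, hCi⟩ := (hmem C).1 hC
    obtain ⟨hD, hDi⟩ := (hmem D).1 hD
    exact h C D hC.1 hD.1 (hCi.trans hDi.symm) hr

/-- A leveled layout, whose edges connect different levels at distance at most `s`, wrapped onto
`2 * s + 1` tracks. -/
def ofLevels (G : SimpleGraph V) (s : ℕ) (ℓ κ : V → ℕ)
    (hinj : ∀ u v, ℓ u = ℓ v → κ u = κ v → u = v)
    (hspan : ∀ u v, G.Adj u v → ℓ u ≠ ℓ v ∧ ℓ u ≤ ℓ v + s)
    (hX : ∀ u v x y, G.Adj u v → G.Adj x y → ℓ u = ℓ x → ℓ v = ℓ y → κ u < κ x → ¬ κ y < κ v) :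
    TrackLayout G (2 * s + 1) where
  track v := Fin.ofNat (2 * s + 1) (ℓ v)
  lt u v := ℓ u < ℓ v ∨ ℓ u = ℓ v ∧ κ u < κ v
  lt_total_order i :=
    { trichotomous := fun u v h1 h2 => Subtype.ext (hinj _ _ (by omega) (by omega))
      irrefl := fun u => by omega
      trans := fun u v w h1 h2 => by omega }
  track_ne u v h e := by
    have h1 := hspan u v h
    have h2 := hspan v u h.symm
    have h3 := Int.eq_zero_of_abs_lt_dvd (Nat.modEq_iff_dvd.1 (congrArg Fin.val e))
      (abs_lt.2 ⟨by omega, by omega⟩)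
    omega
  no_crossing u v x y huv hxy e1 e2 h1 h2 := by
    have s1 := hspan u v huv
    have s2 := hspan v u huv.symm
    have s3 := hspan x y hxy
    have s4 := hspan y x hxy.symm
    -- The level shifts from `u` to `x` and from `v` to `y` differ by at most 2s and are multiples
    -- of 2s+1, so they agree. A nonzero common shift orders both pairs of ends alike.
    have h3 := Int.eq_zero_of_abs_lt_dvd
      (dvd_sub (Nat.modEq_iff_dvd.1 (congrArg Fin.val e1))
        (Nat.modEq_iff_dvd.1 (congrArg Fin.val e2)))
      (abs_lt.2 ⟨by omega, by omega⟩)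
    exact hX u v x y huv hxy (by omega) (by omega) (by omega) (by omega)

end TrackLayout

/-! ### Paths and trees -/

theorem SimpleGraph.IsPathGraph.exists_layout {V : Type*} [Finite V] {G : SimpleGraph V}
    (hG : G.IsPathGraph) : ∃ L : TrackLayout G 2, L.IsCliqueColorable 1 := by
  classical
  obtain ⟨n, ⟨f⟩⟩ := hG
  have hadj : ∀ u v, G.Adj u v → (f u).val + 1 = f v ∨ (f v).val + 1 = f u := fun u v h =>
    SimpleGraph.pathGraph_adj.1 (f.map_adj_iff.2 h)
  let L : TrackLayout G 2 :=
    { track := fun v => Fin.ofNat 2 (f v)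
      lt := fun u v => f u < f v
      lt_total_order := fun i =>
        { trichotomous := fun u v h1 h2 => Subtype.ext (f.injective (le_antisymm
            (not_lt.1 h2) (not_lt.1 h1)))
          irrefl := fun u => lt_irrefl _
          trans := fun u v w => lt_trans }
      track_ne := fun u v h e => by
        have e' : (f u).val % 2 = (f v).val % 2 := congrArg Fin.val e
        have := hadj u v h
        omega
      no_crossing := fun u v x y huv hxy e1 e2 h1 h2 => by
        have e1' : (f u).val % 2 = (f x).val % 2 := congrArg Fin.val e1
        have e2' : (f v).val % 2 = (f y).val % 2 := congrArg Fin.val e2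
        have := hadj u v huv
        have := hadj x y hxy
        rw [Fin.lt_def] at h1 h2
        omega }
  have hcl : ∀ C : Set V, ∃ i : ℕ, G.IsClique C → ∀ u ∈ C, (f u).val = i ∨ (f u).val = i + 1 := by
    intro C
    by_cases hne : C.Nonempty
    · obtain ⟨u, hu, hmin⟩ := Set.exists_min_image C (fun v => (f v).val) (Set.toFinite C) hne
      refine ⟨f u, fun hC v hv => ?_⟩
      rcases eq_or_ne v u with rfl | h
      · exact Or.inl rfl
      · have := hadj v u (hC hv hu h)
        have := hmin v hv
        omega
    · exact ⟨0, fun _ u hu => (hne ⟨u, hu⟩).elim⟩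
  choose rank hrank using hcl
  refine ⟨L, L.isCliqueColorable_of_rank (fun _ => 0) rank ?_⟩
  intro C D hC hD _ hle u hu w hw e
  have e' : (f u).val % 2 = (f w).val % 2 := congrArg Fin.val e
  have h1 := hrank C hC u hu
  have h2 := hrank D hD w hw
  rcases lt_or_eq_of_le (show (f u).val ≤ f w by omega) with h | h
  · exact Or.inr h
  · exact Or.inl (f.injective (Fin.ext h))

/-- Geodesics to `p` and `q` extend to geodesics to `x`, which coincide because paths in a tree are
unique. -/
theorem SimpleGraph.IsTree.eq_of_dist_eq {V : Type*} {G : SimpleGraph V} (hG : G.IsTree)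
    {r x p q : V} (hp : G.Adj p x) (hq : G.Adj q x) (hdp : G.dist r x = G.dist r p + 1)
    (hdq : G.dist r x = G.dist r q + 1) : p = q := by
  obtain ⟨w, hw⟩ := hG.connected.exists_walk_length_eq_dist r p
  obtain ⟨w', hw'⟩ := hG.connected.exists_walk_length_eq_dist r q
  have h1 : (w.concat hp).IsPath := Walk.isPath_of_length_eq_dist _ (by simp [hw, hdp])
  have h2 : (w'.concat hq).IsPath := Walk.isPath_of_length_eq_dist _ (by simp [hw', hdq])
  have := congrArg Walk.penultimate ((hG.existsUnique_path r x).unique h1 h2)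
  simpa using this

/-- The vertices at the same distance from a root of a tree can be ordered such that the order
of the children is compatible with the order of their parents. -/
theorem SimpleGraph.IsTree.exists_order {V : Type*} [Finite V] {G : SimpleGraph V} (hG : G.IsTree)
    (r : V) : ∃ κ : V → ℕ, (∀ u v, G.dist r u = G.dist r v → κ u = κ v → u = v) ∧
      ∀ p q x y, G.Adj p x → G.Adj q y → G.dist r x = G.dist r p + 1 →
        G.dist r y = G.dist r q + 1 → G.dist r x = G.dist r y → κ x < κ y → κ p ≤ κ q := by
  classical
  obtain ⟨n, ⟨e⟩⟩ := Finite.exists_equiv_fin V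
  let par : V → V := fun x =>
    if h : ∃ p, G.Adj p x ∧ G.dist r x = G.dist r p + 1 then h.choose else x
  have hpar : ∀ p x, G.Adj p x → G.dist r x = G.dist r p + 1 → par x = p := fun p x h1 h2 => by
    have h : ∃ p, G.Adj p x ∧ G.dist r x = G.dist r p + 1 := ⟨p, h1, h2⟩
    simp only [par, dif_pos h]
    exact hG.eq_of_dist_eq h.choose_spec.1 h1 h.choose_spec.2 h2
  -- The labels along the path from the root, read as base-n digits with the ancestors most
  -- significant.
  let K : ℕ → V → ℕ := fun k => Nat.rec (fun _ => 0) (fun _ f v => n * f (par v) + e v) k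
  have hK : ∀ k v, K (k + 1) v = n * K k (par v) + e v := fun _ _ => rfl
  refine ⟨fun v => K (G.dist r v) v, fun u v hd h => ?_, ?_⟩
  · rcases hk : G.dist r v with _ | k
    · rw [hk] at hd
      rw [← (hG.connected.dist_eq_zero_iff).1 hd, ← (hG.connected.dist_eq_zero_iff).1 hk]
    · simp only [hd, hk, hK] at h
      have := congrArg (· % n) h
      simp only [Nat.mul_add_mod, Nat.mod_eq_of_lt (e u).2, Nat.mod_eq_of_lt (e v).2] at this
      exact e.injective (Fin.ext this)
  · intro p q x y hp hq hdx hdy hd hlt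
    have hpq : G.dist r q = G.dist r p := by omega
    simp only [hdx, hdy, hpq, hK, hpar p x hp hdx, hpar q y hq hdy] at hlt ⊢
    by_contra! hc
    have h1 : n * (K (G.dist r p) q + 1) ≤ n * K (G.dist r p) p := Nat.mul_le_mul_left n hc
    have := (e y).2
    rw [mul_add] at h1
    omega

theorem SimpleGraph.IsTree.exists_layout {V : Type*} [Finite V] {G : SimpleGraph V}
    (hG : G.IsTree) : ∃ L : TrackLayout G 3, L.IsCliqueColorable 2 := by
  classical
  obtain ⟨r⟩ := hG.connected.nonempty
  obtain ⟨κ, hinj, hκ⟩ := hG.exists_order r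
  set d : V → ℕ := G.dist r with hd
  have hadj : ∀ u v, G.Adj u v → d u = d v + 1 ∨ d v = d u + 1 := fun u v h =>
    hG.dist_eq_dist_add_one_of_adj r h
  have hX : ∀ u v x y, G.Adj u v → G.Adj x y → d u = d x → d v = d y → κ u < κ x →
      ¬ κ y < κ v := by
    intro u v x y huv hxy h1 h2 h3 h4
    rcases hadj u v huv with h | h
    · have := hκ v y u x huv.symm hxy.symm h (by omega) h1 h3
      omega
    · have := hκ x u y v hxy huv (by omega) h (by omega) h4
      omega
  let L : TrackLayout G 3 := TrackLayout.ofLevels G 1 d κ hinj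
    (fun u v h => by have := hadj u v h; omega) hX
  have hcl : ∀ C : Set V, ∃ p q : V, G.IsClique C →
      ∀ u ∈ C, u = p ∨ u = q ∧ G.Adj p q ∧ d q = d p + 1 := by
    intro C
    rcases C.eq_empty_or_nonempty with rfl | hne
    · exact ⟨r, r, by simp⟩
    obtain ⟨p, hp, hmin⟩ := Set.exists_min_image C d (Set.toFinite C) hne
    by_cases h : ∃ q ∈ C, q ≠ p
    · obtain ⟨q, hq, hqp⟩ := h
      refine ⟨p, q, fun hC u hu => ?_⟩
      have lev : ∀ v ∈ C, v ≠ p → d v = d p + 1 := fun v hv h => by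
        have := hadj v p (hC hv hp h)
        have := hmin v hv
        omega
      rcases eq_or_ne u p with rfl | hup
      · exact Or.inl rfl
      refine Or.inr ⟨by_contra fun huq => ?_, (hC hp hq hqp.symm), lev q hq hqp⟩
      have := hadj u q (hC hu hq huq)
      have := lev u hu hup
      have := lev q hq hqp
      omega
    · push Not at h
      exact ⟨p, p, fun _ u hu => Or.inl (h u hu)⟩
  choose p q hpq using hcl
  refine ⟨L, L.isCliqueColorable_of_rank (fun C => Fin.ofNat 2 (d (p C)))
    (fun C => toLex (d (p C), toLex (κ (p C), κ (q C)))) ?_⟩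
  intro C D hC hD hcol hle u hu w hw e
  have e' : d u % 3 = d w % 3 := congrArg Fin.val e
  have hcol' : d (p C) % 2 = d (p D) % 2 := congrArg Fin.val hcol
  simp only [Prod.Lex.toLex_le_toLex] at hle
  -- If the upper ends differ in depth, equal color makes the gap at least two, so levels decide.
  -- Otherwise the upper ends are compared by rank and the lower ends by `hX`.
  have key : d u < d w ∨ d u = d w ∧ κ u ≤ κ w := by
    have h := hpq C hC u hu
    have h' := hpq D hD w hw
    generalize p C = a at *
    generalize p D = a' at *
    generalize q C = b at *
    generalize q D = b' at *
    rcases h with rfl | ⟨rfl, h1, h2⟩ <;> rcases h' with rfl | ⟨rfl, h1', h2'⟩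
    · omega
    · omega
    · omega
    · have := hX a u a' w h1 h1'
      omega
  rcases key with h | ⟨h1, h2⟩
  · exact Or.inr (Or.inl h)
  · rcases h2.lt_or_eq with h | h
    · exact Or.inr (Or.inr ⟨h1, h⟩)
    · exact Or.inl (hinj u w h1 h)

/-! ### Outerplanar graphs -/

/-- A pairwise `E`-related set lies in a triangle whose vertices are on three consecutive levels. -/
theorem IsLeveledTriangulation.exists_sorted_triangle {E ℓ H} {a b : ℕ}
    (h : IsLeveledTriangulation E ℓ H a b) (hab : a + 1 < b) {S : Set ℕ} (hS : S ⊆ Set.Icc a b)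
    (hSE : S.Pairwise E) : ∃ x y z, (H x y ∨ H y x) ∧ (H y z ∨ H z y) ∧ (H x z ∨ H z x) ∧
      ℓ y = ℓ x + 1 ∧ ℓ z = ℓ x + 2 ∧ S ⊆ {x, y, z} := by
  rcases h.clique S hS hSE with ⟨h1, -⟩ | ⟨x, y, z, hxy, hyz, hxz, hSt⟩
  · omega
  have s1 := h.span _ _ hxy
  have s2 := h.span _ _ hyz
  have s3 := h.span _ _ hxz
  have hS' : ∀ x' y' z', ({x, y, z} : Set ℕ) ⊆ {x', y', z'} → S ⊆ {x', y', z'} :=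
    fun _ _ _ h => hSt.trans h
  -- Three distinct levels pairwise at most two apart are consecutive; the cases are the six orders
  -- of the corners.
  by_cases c1 : ℓ y = ℓ x + 1 ∧ ℓ z = ℓ x + 2
  · exact ⟨x, y, z, by tauto, by tauto, by tauto, by omega, by omega, hSt⟩
  by_cases c2 : ℓ z = ℓ x + 1 ∧ ℓ y = ℓ x + 2
  · exact ⟨x, z, y, by tauto, by tauto, by tauto, by omega, by omega, hS' _ _ _ (by grind)⟩
  by_cases c3 : ℓ x = ℓ y + 1 ∧ ℓ z = ℓ y + 2
  · exact ⟨y, x, z, by tauto, by tauto, by tauto, by omega, by omega, hS' _ _ _ (by grind)⟩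
  by_cases c4 : ℓ z = ℓ y + 1 ∧ ℓ x = ℓ y + 2
  · exact ⟨y, z, x, by tauto, by tauto, by tauto, by omega, by omega, hS' _ _ _ (by grind)⟩
  by_cases c5 : ℓ x = ℓ z + 1 ∧ ℓ y = ℓ z + 2
  · exact ⟨z, x, y, by tauto, by tauto, by tauto, by omega, by omega, hS' _ _ _ (by grind)⟩
  · exact ⟨z, y, x, by tauto, by tauto, by tauto, by omega, by omega, hS' _ _ _ (by grind)⟩

/-- The rank of the triangle `x, y, z` whose levels are `m`, `m + 1`, `m + 2`: among the triangles
with the same `m / 2`, compare the vertices on the two levels that all of them meet, then `m`, then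
the remaining vertices. -/
def triangleRank (m x y z : ℕ) : ℕ ×ₗ ℕ ×ₗ ℕ ×ₗ ℕ ×ₗ ℕ :=
  if m % 2 = 0 then toLex (m / 2, toLex (z, toLex (y, toLex (0, x))))
  else toLex (m / 2, toLex (y, toLex (x, toLex (1, z))))

theorem triangleRank_compare {ℓ : ℕ → ℕ} {K : ℕ → ℕ → Prop} (hK : ∀ x y, K x y → K y x)
    (hX : ∀ u v x y, K u v → K x y → ℓ u = ℓ x → ℓ v = ℓ y → u < x → ¬ y < v)
    {x y z x' y' z' : ℕ} (hxy : K x y) (hyz : K y z) (hxz : K x z) (hy : ℓ y = ℓ x + 1)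
    (hz : ℓ z = ℓ x + 2) (hxy' : K x' y') (hyz' : K y' z') (hxz' : K x' z') (hy' : ℓ y' = ℓ x' + 1)
    (hz' : ℓ z' = ℓ x' + 2) (hc : ℓ x / 2 % 2 = ℓ x' / 2 % 2)
    (hle : triangleRank (ℓ x) x y z ≤ triangleRank (ℓ x') x' y' z') {u w : ℕ}
    (hu : u = x ∨ u = y ∨ u = z) (hw : w = x' ∨ w = y' ∨ w = z') (huw : ℓ u % 5 = ℓ w % 5) :
    ℓ u < ℓ w ∨ ℓ u = ℓ w ∧ u ≤ w := by
  have hk : ℓ x / 2 ≤ ℓ x' / 2 := by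
    unfold triangleRank at hle
    split_ifs at hle <;> simp only [Prod.Lex.toLex_le_toLex] at hle <;> omega
  -- Equal color forces unequal halves to differ by at least two, so the levels are disjoint.
  rcases hk.lt_or_eq with hk | hk
  · left
    rcases hu with rfl | rfl | rfl <;> rcases hw with rfl | rfl | rfl <;> omega
  -- With k = ⌊m/2⌋ common, only the four levels 2k, …, 2k+3 occur, so five tracks separate them.
  have huw' : ℓ u = ℓ w := by
    rcases hu with rfl | rfl | rfl <;> rcases hw with rfl | rfl | rfl <;> omega
  refine Or.inr ⟨huw', ?_⟩
  rcases Nat.mod_two_eq_zero_or_one (ℓ x) with hm | hm <;>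
    rcases Nat.mod_two_eq_zero_or_one (ℓ x') with hm' | hm' <;>
    simp only [triangleRank, hm, hm', if_true, if_false, one_ne_zero,
      Prod.Lex.toLex_le_toLex] at hle
  · have f1 := hX z y z' y' (hK _ _ hyz) (hK _ _ hyz')
    have f2 := hX z x z' x' (hK _ _ hxz) (hK _ _ hxz')
    have f3 := hX y x y' x' (hK _ _ hxy) (hK _ _ hxy')
    rcases hu with rfl | rfl | rfl <;> rcases hw with rfl | rfl | rfl <;> omega
  · have f1 := hX z y y' x' (hK _ _ hyz) (hK _ _ hxy')
    rcases hu with rfl | rfl | rfl <;> rcases hw with rfl | rfl | rfl <;> omega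
  · have f1 := hX y x z' y' (hK _ _ hxy) (hK _ _ hyz')
    rcases hu with rfl | rfl | rfl <;> rcases hw with rfl | rfl | rfl <;> omega
  · have f1 := hX y x y' x' (hK _ _ hxy) (hK _ _ hxy')
    have f2 := hX y z y' z' hyz hyz'
    have f3 := hX x z x' z' hxz hxz'
    rcases hu with rfl | rfl | rfl <;> rcases hw with rfl | rfl | rfl <;> omega

theorem SimpleGraph.IsOuterplanar.exists_layout {V : Type*} [Finite V] {G : SimpleGraph V}
    (hG : G.IsOuterplanar) : ∃ L : TrackLayout G 5, L.IsCliqueColorable 2 := by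
  classical
  obtain ⟨pos, hpos, hcross⟩ := hG.exists_numbering
  obtain ⟨N, hN⟩ : ∃ N, ∀ v, pos v ≤ N := by
    obtain ⟨N, hN⟩ := (Set.finite_range pos).bddAbove
    exact ⟨N, fun v => hN ⟨v, rfl⟩⟩
  let E : ℕ → ℕ → Prop := fun x y => ∃ u v, G.Adj u v ∧ pos u = x ∧ pos v = y
  obtain ⟨ℓ, H, hT, -, -⟩ := exists_isLeveledTriangulation (E := E)
    (by
      rintro _ _ _ _ ⟨a, b, hab, rfl, rfl⟩ ⟨c, d, hcd, rfl, rfl⟩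
      exact hcross a b c d hab hcd)
    -- The extra length makes the base longer than one step, which excludes the triangle-free
    -- alternative in `clique`.
    (N + 2) 0 (N + 2) 0 1 (by omega) (by omega) (by omega) (by omega) (by omega)
  let K : ℕ → ℕ → Prop := fun x y => H x y ∨ H y x
  have hK : ∀ x y, K x y → K y x := fun _ _ => Or.symm
  have hX : ∀ u v x y, K u v → K x y → ℓ u = ℓ x → ℓ v = ℓ y → u < x → ¬ y < v :=
    fun u v x y h1 h2 => hT.not_cross h1 h2
  have hGK : ∀ u v, G.Adj u v → K (pos u) (pos v) := fun u v h => by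
    rcases lt_or_gt_of_ne (fun h' => h.ne (hpos h')) with h' | h'
    · exact Or.inl (hT.cover _ _ ⟨u, v, h, rfl, rfl⟩ (Nat.zero_le _) h'
        ((hN v).trans (by omega)))
    · exact Or.inr (hT.cover _ _ ⟨v, u, h.symm, rfl, rfl⟩ (Nat.zero_le _) h'
        ((hN u).trans (by omega)))
  let L : TrackLayout G 5 := TrackLayout.ofLevels G 2 (fun v => ℓ (pos v)) pos
    (fun u v _ h => hpos h)
    (fun u v h => by
      rcases hGK u v h with h | h
      · have := hT.span _ _ h
        omega
      · have := hT.span _ _ h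
        omega)
    (fun u v x y huv hxy => hX _ _ _ _ (hGK u v huv) (hGK x y hxy))
  have hcl : ∀ C : Set V, ∃ x y z, G.IsClique C → K x y ∧ K y z ∧ K x z ∧
      ℓ y = ℓ x + 1 ∧ ℓ z = ℓ x + 2 ∧ pos '' C ⊆ {x, y, z} := by
    intro C
    by_cases hC : G.IsClique C
    · obtain ⟨x, y, z, h⟩ := hT.exists_sorted_triangle (S := pos '' C) (by omega)
        (by
          rintro _ ⟨v, -, rfl⟩
          exact ⟨Nat.zero_le _, (hN v).trans (by omega)⟩)
        (by
          rintro _ ⟨u, hu, rfl⟩ _ ⟨v, hv, rfl⟩ hne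
          exact ⟨u, v, hC hu hv (fun h => hne (congrArg pos h)), rfl, rfl⟩)
      exact ⟨x, y, z, fun _ => h⟩
    · exact ⟨0, 0, 0, fun h => (hC h).elim⟩
  choose x y z hxyz using hcl
  refine ⟨L, L.isCliqueColorable_of_rank (fun C => Fin.ofNat 2 (ℓ (x C) / 2))
    (fun C => triangleRank (ℓ (x C)) (x C) (y C) (z C)) ?_⟩
  intro C D hC hD hcol hle u hu w hw e
  obtain ⟨a1, a2, a3, a4, a5, a6⟩ := hxyz C hC
  obtain ⟨b1, b2, b3, b4, b5, b6⟩ := hxyz D hD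
  rcases triangleRank_compare hK hX a1 a2 a3 a4 a5 b1 b2 b3 b4 b5 (congrArg Fin.val hcol) hle
    (a6 ⟨u, hu, rfl⟩) (b6 ⟨w, hw, rfl⟩) (congrArg Fin.val e) with h | ⟨h1, h2⟩
  · exact Or.inr (Or.inl h)
  · rcases h2.lt_or_eq with h | h
    · exact Or.inr (Or.inr ⟨h1, h⟩)
    · exact Or.inl (hpos h)

theorem mainTheorem5 {V : Type*} [Finite V] (G : SimpleGraph V) :
    (G.IsPathGraph → ∃ L : TrackLayout G 2, L.IsCliqueColorable 1) ∧
    (G.IsTree → ∃ L : TrackLayout G 3, L.IsCliqueColorable 2) ∧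
    (G.IsOuterplanar → ∃ L : TrackLayout G 5, L.IsCliqueColorable 2) :=
  ⟨fun h => h.exists_layout, fun h => h.exists_layout, fun h => h.exists_layout⟩
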